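/- Let $G$ be a finite connected simple graph. A tour of length $\ell$ on $G$ is a closed walk $v_0,e_1,v_1,\ldots,e_\ell,v_\ell=v_0$ (with any starting vertex $v_0$; vertices and edges may repeat, and tours with different starting vertices are different). A tour is balanced if it traverses every edge equally often in each of its two directions; such a tour has even length. For $k\ge 0$ let $W^B_k$ be the number of balanced tours of length $2k$ on $G$, and let $W^E_k$ be the number of all tours of length $2k$ on $G$. Let $\rho(G)$ be the largest eigenvalue of the adjacency matrix of $G$. Then the families of balanced tours and of even-length tours, in both of which the size of a tour is half its length, have the same growth rate $\rho(G)^2$; that is, both of the following limits exist and $$\lim_{k\to\infty}\bigl(W^B_k\bigr)^{1/k}\;=\;\lim_{k\to\infty}\bigl(W^E_k\bigr)^{1/k}\;=\;\rho(G)^2 .$$ -/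

import Mathlib

namespace GraphTours

variable {V : Type*}

/-- A tour on `G` is a closed walk on `G`, together with the vertex at which it starts and ends. -/
abbrev Tour (G : SimpleGraph V) : Type _ := Σ u : V, G.Walk u u

/-- The length of a tour: the number of edge traversals, counted with multiplicity. -/
def Tour.length {G : SimpleGraph V} (t : Tour G) : ℕ := SimpleGraph.Walk.length t.2

/-- A tour is balanced if every edge is traversed equally often in each of its two directions.
A dart of `G` is an edge with a direction, and `d.symm` is the same edge directed the other way. -/
def Tour.IsBalanced [DecidableEq V] {G : SimpleGraph V} (t : Tour G) : Prop :=
  ∀ d : G.Dart, t.2.darts.count d = t.2.darts.count d.symm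

/-- The family of all balanced tours on `G`, with any starting vertex. -/
def balancedTours [DecidableEq V] (G : SimpleGraph V) : Set (Tour G) :=
  {t | t.IsBalanced}

/-- The family of all tours of even length on `G`, with any starting vertex. -/
def evenTours (G : SimpleGraph V) : Set (Tour G) :=
  {t | Even t.length}

/-- The number of tours of size `k` in a family, the size of a tour being half its length. -/
noncomputable def numOfSize {G : SimpleGraph V} (F : Set (Tour G)) (k : ℕ) : ℕ :=
  {t | t ∈ F ∧ t.length = 2 * k}.ncard

/-- On a finite graph the sets counted by `numOfSize` are finite. -/
theorem finite_ofSize [Finite V] {G : SimpleGraph V} (F : Set (Tour G)) (k : ℕ) :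
    {t | t ∈ F ∧ t.length = 2 * k}.Finite := by
  classical
  have := Fintype.ofFinite V
  refine Set.Finite.subset (Set.finite_iUnion
    (f := fun u : V => (fun p : G.Walk u u => (⟨u, p⟩ : Tour G)) '' {p | p.length = 2 * k})
    (fun u => (Set.toFinite _).image _)) ?_
  rintro ⟨u, p⟩ ⟨-, hp⟩
  exact Set.mem_iUnion.2 ⟨u, p, hp, rfl⟩

/-- A family of tours has growth rate `g` if the `k`-th root of the number of its members of
size `k` converges to `g`. -/
def HasGrowthRate {G : SimpleGraph V} (F : Set (Tour G)) (g : ℝ) : Prop :=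
  Filter.Tendsto (fun k : ℕ => (numOfSize F k : ℝ) ^ (1 / (k : ℝ))) Filter.atTop (nhds g)

/-- The real eigenvalues of the adjacency matrix of `G`. -/
def adjEigenvalues [Fintype V] [DecidableEq V] (G : SimpleGraph V) [DecidableRel G.Adj] : Set ℝ :=
  {x | Module.End.HasEigenvalue (Matrix.toLin' (G.adjMatrix ℝ)) x}

/-- The spectral radius of `G`: the largest eigenvalue of its adjacency matrix. -/
noncomputable def spectralRadius [Fintype V] [DecidableEq V] (G : SimpleGraph V)
    [DecidableRel G.Adj] : ℝ :=
  sSup (adjEigenvalues G)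

/-- The supremum in `spectralRadius` is attained. -/
theorem isGreatest_spectralRadius [Fintype V] [DecidableEq V] [Nonempty V] (G : SimpleGraph V)
    [DecidableRel G.Adj] : IsGreatest (adjEigenvalues G) (spectralRadius G) := by
  have hfin : (adjEigenvalues G).Finite := Module.End.finite_hasEigenvalue _
  have hA : (G.adjMatrix ℝ).IsHermitian := by
    rw [Matrix.IsHermitian, Matrix.conjTranspose_eq_transpose_of_trivial]
    exact G.transpose_adjMatrix
  have hne : (adjEigenvalues G).Nonempty := by
    refine ⟨hA.eigenvalues (Classical.arbitrary V), ?_⟩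
    have h := hA.eigenvalues_mem_spectrum_real (Classical.arbitrary V)
    rw [← Matrix.spectrum_toLin'] at h
    exact Module.End.hasEigenvalue_iff_mem_spectrum.2 h
  exact ⟨hne.csSup_mem hfin, fun x hx => le_csSup hfin.bddAbove hx⟩

end GraphTours

namespace GraphTours

open Filter Finset Topology

/-! ### Polynomial factors do not affect growth rates. -/

section Limits

/-! Write `A` for the adjacency matrix and `ρ` for its largest eigenvalue. Since `A` has nonnegative
entries, all eigenvalues satisfy `|λ| ≤ ρ`, so there are at most `tr A^(2k) = ∑ λ^(2k) ≤ |V| ρ^(2k)`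
tours of length `2k`. For the lower bound, sort the walks of length `k` from `u` to `v` by how often
they use each dart. Following one walk and returning along another of the same class is a balanced
tour, so a class has at most `√(W^B_k)` members (`card_sq_le_numOfSize_balancedTours`). There are
only polynomially many classes, and some row sum of `A^k` is at least `ρ^k`; hence `ρ^(2k)` is at
most a polynomial in `k` times `W^B_k`. -/

theorem tendsto_const_mul_succ_pow_rpow_inv {C : ℝ} (hC : 0 < C) (m : ℕ) :
    Tendsto (fun k : ℕ => (C * ((k : ℝ) + 1) ^ m) ^ (1 / (k : ℝ))) atTop (𝓝 1) := by
  have h1 : Tendsto (fun k : ℕ => C ^ (1 / (k : ℝ))) atTop (𝓝 1) := by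
    have h := (Real.continuous_const_rpow hC.ne').tendsto 0
    rw [Real.rpow_zero] at h
    exact h.comp tendsto_one_div_atTop_nhds_zero_nat
  have h2 : Tendsto (fun k : ℕ => ((k : ℝ) + 1) ^ (1 / (k : ℝ))) atTop (𝓝 1) := by
    -- The function is `x ^ (1 / (x - 1))`, taken at `x = k + 1`.
    have h := (tendsto_rpow_div_mul_add 1 1 (-1) zero_ne_one).comp
      (tendsto_atTop_add_const_right atTop (1 : ℝ) tendsto_natCast_atTop_atTop)
    refine h.congr fun k => ?_
    simp
  have h3 := h1.mul (h2.pow m)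
  rw [one_pow, mul_one] at h3
  refine h3.congr fun k => ?_
  have hk : (0 : ℝ) ≤ (k : ℝ) + 1 := by positivity
  rw [Real.mul_rpow hC.le (by positivity), ← Real.rpow_natCast, ← Real.rpow_natCast,
    ← Real.rpow_mul hk, ← Real.rpow_mul hk, mul_comm (m : ℝ)]

/-- A sequence that agrees with `r ^ k` up to polynomial factors has growth rate `r`. -/
theorem tendsto_rpow_inv_of_le_of_le {f : ℕ → ℝ} {r C : ℝ} (hr : 0 ≤ r) (hC : 0 < C) (m : ℕ)
    (hf : ∀ k, 0 ≤ f k) (hlow : ∀ k : ℕ, r ^ k ≤ C * ((k : ℝ) + 1) ^ m * f k)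
    (hup : ∀ k, f k ≤ C * r ^ k) :
    Tendsto (fun k : ℕ => f k ^ (1 / (k : ℝ))) atTop (𝓝 r) := by
  have hroot : ∀ k : ℕ, k ≠ 0 → (r ^ k) ^ (1 / (k : ℝ)) = r := fun k hk => by
    rw [one_div, Real.pow_rpow_inv_natCast hr hk]
  have hl : Tendsto (fun k : ℕ => r / (C * ((k : ℝ) + 1) ^ m) ^ (1 / (k : ℝ))) atTop (𝓝 r) := by
    have h := (tendsto_const_nhds (x := r)).div
      (tendsto_const_mul_succ_pow_rpow_inv hC m) one_ne_zero
    rwa [div_one] at h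
  have hu : Tendsto (fun k : ℕ => (C * ((k : ℝ) + 1) ^ 0) ^ (1 / (k : ℝ)) * r) atTop (𝓝 r) := by
    simpa using (tendsto_const_mul_succ_pow_rpow_inv hC 0).mul_const r
  refine tendsto_of_tendsto_of_tendsto_of_le_of_le' hl hu ?_ ?_
  · filter_upwards [eventually_ne_atTop 0] with k hk
    rw [div_le_iff₀ (by positivity), mul_comm, ← Real.mul_rpow (by positivity) (hf k)]
    calc r = (r ^ k) ^ (1 / (k : ℝ)) := (hroot k hk).symm
      _ ≤ _ := Real.rpow_le_rpow (by positivity) (hlow k) (by positivity)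
  · filter_upwards [eventually_ne_atTop 0] with k hk
    calc f k ^ (1 / (k : ℝ)) ≤ (C * r ^ k) ^ (1 / (k : ℝ)) :=
          Real.rpow_le_rpow (hf k) (hup k) (by positivity)
      _ = _ := by rw [Real.mul_rpow hC.le (by positivity), hroot k hk, pow_zero, mul_one]

end Limits

/-! ### Eigenvalues of symmetric and nonnegative matrices. -/

section Matrices

variable {n : Type*} [Fintype n] [DecidableEq n]

open Matrix

theorem trace_pow_eq_sum_eigenvalues_pow {A : Matrix n n ℝ} (hA : A.IsHermitian) (k : ℕ) :
    (A ^ k).trace = ∑ i, hA.eigenvalues i ^ k := by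
  conv_lhs => rw [hA.spectral_theorem]
  rw [← map_pow, Unitary.conjStarAlgAut_apply, Matrix.trace_mul_cycle, Unitary.coe_star_mul_self,
    one_mul, diagonal_pow, Matrix.trace_diagonal]
  simp

/-- The eigenvalues of `r • 1 - A` are the `r - y` with `y` an eigenvalue of `A`, so this matrix is
positive semidefinite. -/
theorem dotProduct_mulVec_le_of_hasEigenvalue_le {A : Matrix n n ℝ} (hA : A.IsHermitian) {r : ℝ}
    (hr : ∀ x, Module.End.HasEigenvalue (toLin' A) x → x ≤ r) (x : n → ℝ) :
    x ⬝ᵥ A *ᵥ x ≤ r * (x ⬝ᵥ x) := by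
  have hB : (r • (1 : Matrix n n ℝ) - A).IsHermitian := by
    refine IsHermitian.sub ?_ hA
    simp [IsHermitian]
  have hpos : (r • (1 : Matrix n n ℝ) - A).PosSemidef := by
    refine hB.posSemidef_iff_eigenvalues_nonneg.2 fun i => ?_
    have h := hB.eigenvalues_mem_spectrum_real i
    generalize hB.eigenvalues i = e at h ⊢
    rw [← Algebra.algebraMap_eq_smul_one, ← spectrum.singleton_sub_eq, Set.singleton_sub] at h
    obtain ⟨y, hy, rfl⟩ := h
    rw [← Matrix.spectrum_toLin'] at hy
    exact sub_nonneg.2 (hr y (Module.End.hasEigenvalue_iff_mem_spectrum.2 hy))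
  have h := hpos.dotProduct_mulVec_nonneg x
  simp only [star_trivial, sub_mulVec, smul_mulVec, one_mulVec, dotProduct_sub, dotProduct_smul,
    smul_eq_mul] at h
  linarith

/-- For a symmetric matrix with nonnegative entries, an upper bound for the eigenvalues bounds
their absolute values. -/
theorem abs_le_of_hasEigenvalue {A : Matrix n n ℝ} (hA : A.IsHermitian) (hA0 : ∀ i j, 0 ≤ A i j)
    {r : ℝ} (hr : ∀ x, Module.End.HasEigenvalue (toLin' A) x → x ≤ r) {y : ℝ}
    (hy : Module.End.HasEigenvalue (toLin' A) y) : |y| ≤ r := by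
  obtain ⟨x, hx⟩ := hy.exists_hasEigenvector
  have hxe : A *ᵥ x = y • x := by simpa using hx.apply_eq_smul
  have hpos : 0 < x ⬝ᵥ x :=
    lt_of_le_of_ne (sum_nonneg fun i _ => mul_self_nonneg (x i))
      fun h => hx.2 (dotProduct_self_eq_zero.1 h.symm)
  -- Replacing `x` by its entrywise absolute value keeps the norm and, as `A` is nonnegative, bounds
  -- the quadratic form from above.
  have habs : (fun i => |x i|) ⬝ᵥ (fun i => |x i|) = x ⬝ᵥ x := by simp [dotProduct]
  have h1 : |y| * (x ⬝ᵥ x) = |x ⬝ᵥ A *ᵥ x| := by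
    rw [hxe, dotProduct_smul, smul_eq_mul, abs_mul, abs_of_pos hpos]
  have h2 : |x ⬝ᵥ A *ᵥ x| ≤ (fun i => |x i|) ⬝ᵥ A *ᵥ (fun i => |x i|) := by
    simp only [dotProduct, mulVec]
    refine (abs_sum_le_sum_abs _ _).trans (sum_le_sum fun i _ => ?_)
    rw [abs_mul]
    refine mul_le_mul_of_nonneg_left ?_ (abs_nonneg _)
    refine (abs_sum_le_sum_abs _ _).trans (sum_le_sum fun j _ => ?_)
    rw [abs_mul, abs_of_nonneg (hA0 i j)]
  have h3 := dotProduct_mulVec_le_of_hasEigenvalue_le hA hr (fun i => |x i|)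
  rw [habs] at h3
  exact le_of_mul_le_mul_right (h1.le.trans (h2.trans h3)) hpos

/-- A power of an eigenvalue is bounded by some row sum of absolute values. -/
theorem exists_abs_pow_le_sum_row {A : Matrix n n ℝ} {y : ℝ}
    (hy : Module.End.HasEigenvalue (toLin' A) y) (k : ℕ) :
    ∃ i, |y| ^ k ≤ ∑ j, |(A ^ k) i j| := by
  obtain ⟨x, hx⟩ := hy.exists_hasEigenvector
  have hxk : (A ^ k) *ᵥ x = y ^ k • x := by
    have := hx.pow_apply k
    rwa [← toLin'_pow, toLin'_apply] at this
  obtain ⟨a, ha⟩ := Function.ne_iff.1 hx.2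
  have : Nonempty n := ⟨a⟩
  -- The row is that of an eigenvector entry of largest modulus.
  obtain ⟨i, hi⟩ := Finite.exists_max fun i => |x i|
  have hpos : 0 < |x i| := (abs_pos.2 ha).trans_le (hi a)
  refine ⟨i, le_of_mul_le_mul_right ?_ hpos⟩
  calc |y| ^ k * |x i| = |((A ^ k) *ᵥ x) i| := by simp [hxk, abs_mul, abs_pow]
    _ ≤ ∑ j, |(A ^ k) i j * x j| := abs_sum_le_sum_abs _ _
    _ ≤ ∑ j, |(A ^ k) i j| * |x i| := sum_le_sum fun j _ => by
        rw [abs_mul]; exact mul_le_mul_of_nonneg_left (hi j) (abs_nonneg _)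
    _ = _ := (sum_mul _ _ _).symm

end Matrices

/-! ### Gluing walks into balanced tours. -/

section Walks

variable {V : Type*} {G : SimpleGraph V}

/-- The common length `k` locates the cut in the list of darts, and the darts determine each half.
-/
theorem append_reverse_injective {u v : V} {k : ℕ} {p q p' q' : G.Walk u v} (hp : p.length = k)
    (hp' : p'.length = k) (h : p.append q.reverse = p'.append q'.reverse) : p = p' ∧ q = q' := by
  have hd := congrArg SimpleGraph.Walk.darts h
  rw [SimpleGraph.Walk.darts_append, SimpleGraph.Walk.darts_append] at hd
  obtain ⟨h1, h2⟩ := List.append_inj hd (by simp [hp, hp'])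
  exact ⟨SimpleGraph.Walk.darts_injective h1,
    SimpleGraph.Walk.reverse_injective (SimpleGraph.Walk.darts_injective h2)⟩

/-- Only tours of length `2 * k` are counted, so evenness may be assumed; no separate proof that
balanced tours are even is needed. -/
theorem numOfSize_mono [Fintype V] {F F' : Set (Tour G)}
    (h : ∀ t ∈ F, Even t.length → t ∈ F') (k : ℕ) :
    numOfSize F k ≤ numOfSize F' k :=
  Set.ncard_le_ncard (fun t ht => ⟨h t ht.1 (ht.2 ▸ even_two_mul k), ht.2⟩) (finite_ofSize F' k)

variable [DecidableEq V]

theorem count_darts_reverse {u v : V} (q : G.Walk u v) (d : G.Dart) :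
    q.reverse.darts.count d = q.darts.count d.symm := by
  rw [SimpleGraph.Walk.darts_reverse, List.count_reverse]
  conv_lhs => rw [← SimpleGraph.Dart.symm_symm d]
  exact List.count_map_of_injective _ _ SimpleGraph.Dart.symm_involutive.injective _

/-- Two walks with the same ends that use every dart equally often close up to a balanced tour. -/
theorem isBalanced_append_reverse {u v : V} {p q : G.Walk u v}
    (h : ∀ d, p.darts.count d = q.darts.count d) :
    Tour.IsBalanced (⟨u, p.append q.reverse⟩ : Tour G) := by
  intro d
  simp only [SimpleGraph.Walk.darts_append, List.count_append, count_darts_reverse, h,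
    SimpleGraph.Dart.symm_symm]
  exact add_comm _ _

variable [Fintype V]

variable [DecidableRel G.Adj]

theorem card_finsetWalkLength_eq (k : ℕ) (u v : V) :
    ((G.finsetWalkLength k u v).card : ℝ) = (G.adjMatrix ℝ ^ k) u v := by
  rw [SimpleGraph.adjMatrix_pow_apply_eq_card_walk, SimpleGraph.card_set_walk_length_eq]

theorem numOfSize_le_trace (F : Set (Tour G)) (k : ℕ) :
    (numOfSize F k : ℝ) ≤ (G.adjMatrix ℝ ^ (2 * k)).trace := by
  have h : numOfSize F k ≤ (univ.sigma fun u => G.finsetWalkLength (2 * k) u u).card := by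
    rw [← Set.ncard_coe_finset]
    refine Set.ncard_le_ncard ?_ (finite_toSet _)
    rintro ⟨u, p⟩ ⟨-, hp⟩
    simpa [SimpleGraph.mem_finsetWalkLength_iff, Tour.length] using hp
  rw [card_sigma] at h
  calc (numOfSize F k : ℝ) ≤ ((∑ u, (G.finsetWalkLength (2 * k) u u).card : ℕ) : ℝ) := by
        exact_mod_cast h
    _ = _ := by simp [Matrix.trace, card_finsetWalkLength_eq]

theorem card_sq_le_numOfSize_balancedTours (k : ℕ) (u v : V) (c : G.Dart → ℕ) :
    ((G.finsetWalkLength k u v).filter fun p => (fun d => p.darts.count d) = c).card ^ 2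
      ≤ numOfSize (balancedTours G) k := by
  set S := (G.finsetWalkLength k u v).filter fun p => (fun d => p.darts.count d) = c with hS
  have hmem : ∀ p ∈ S, p.length = k ∧ ∀ d, p.darts.count d = c d := fun p hp => by
    rw [hS, mem_filter, SimpleGraph.mem_finsetWalkLength_iff] at hp
    exact ⟨hp.1, fun d => congrFun hp.2 d⟩
  rw [sq, ← card_product, ← Set.ncard_coe_finset, numOfSize]
  refine Set.ncard_le_ncard_of_injOn
    (fun x : G.Walk u v × G.Walk u v => (⟨u, x.1.append x.2.reverse⟩ : Tour G)) ?_ ?_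
    (finite_ofSize _ k)
  · rintro ⟨p, q⟩ hpq
    obtain ⟨hp, hq⟩ := mem_product.1 (mem_coe.1 hpq)
    refine ⟨isBalanced_append_reverse fun d => ?_, ?_⟩
    · rw [(hmem p hp).2, (hmem q hq).2]
    · simp [Tour.length, (hmem p hp).1, (hmem q hq).1, two_mul]
  · rintro ⟨p, q⟩ hpq ⟨p', q'⟩ hpq' h
    obtain ⟨h1, h2⟩ := append_reverse_injective (hmem p (mem_product.1 (mem_coe.1 hpq)).1).1
      (hmem p' (mem_product.1 (mem_coe.1 hpq')).1).1 (eq_of_heq (Sigma.mk.inj h).2)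
    exact Prod.ext h1 h2

/-- Walks of length `k` between two vertices fall into polynomially many classes according to how
often they use each dart. -/
theorem card_finsetWalkLength_le (k : ℕ) (u v : V) :
    ((G.finsetWalkLength k u v).card : ℝ) ≤
      ((k : ℝ) + 1) ^ Fintype.card G.Dart * √(numOfSize (balancedTours G) k) := by
  -- Each dart is used between `0` and `k` times, which bounds the number of classes.
  have hmaps : Set.MapsTo (fun (p : G.Walk u v) (d : G.Dart) => p.darts.count d)
      (G.finsetWalkLength k u v) (Fintype.piFinset fun _ : G.Dart => range (k + 1)) := by
    intro p hp
    rw [mem_coe, SimpleGraph.mem_finsetWalkLength_iff] at hp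
    rw [mem_coe, Fintype.mem_piFinset]
    intro d
    rw [mem_range, Nat.lt_succ_iff, ← hp, ← SimpleGraph.Walk.length_darts]
    exact List.count_le_length
  rw [card_eq_sum_card_fiberwise hmaps, Nat.cast_sum]
  refine (sum_le_card_nsmul _ _ (√(numOfSize (balancedTours G) k)) fun c _ => ?_).trans_eq ?_
  · refine Real.le_sqrt_of_sq_le ?_
    exact_mod_cast card_sq_le_numOfSize_balancedTours k u v c
  · simp [Fintype.card_piFinset]

end Walks

/-! ### Two-sided bounds in terms of the spectral radius. -/

section Bounds

variable {V : Type*} [Fintype V] [DecidableEq V] [Nonempty V] (G : SimpleGraph V)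
  [DecidableRel G.Adj]

theorem abs_le_spectralRadius {x : ℝ} (hx : x ∈ adjEigenvalues G) : |x| ≤ spectralRadius G :=
  abs_le_of_hasEigenvalue (by
      rw [Matrix.IsHermitian, Matrix.conjTranspose_eq_transpose_of_trivial]
      exact G.transpose_adjMatrix)
    (fun i j => by rw [SimpleGraph.adjMatrix_apply]; split_ifs <;> norm_num)
    (fun _ hy => (isGreatest_spectralRadius G).2 hy) hx

theorem spectralRadius_nonneg : 0 ≤ spectralRadius G :=
  (abs_nonneg _).trans (abs_le_spectralRadius G (isGreatest_spectralRadius G).1)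

theorem numOfSize_le_card_mul_spectralRadius_pow (F : Set (Tour G)) (k : ℕ) :
    (numOfSize F k : ℝ) ≤ Fintype.card V * (spectralRadius G ^ 2) ^ k := by
  have hA : (G.adjMatrix ℝ).IsHermitian := by
    rw [Matrix.IsHermitian, Matrix.conjTranspose_eq_transpose_of_trivial]
    exact G.transpose_adjMatrix
  refine (numOfSize_le_trace F k).trans ?_
  rw [trace_pow_eq_sum_eigenvalues_pow hA]
  refine (sum_le_card_nsmul _ _ ((spectralRadius G ^ 2) ^ k) fun i _ => ?_).trans_eq (by simp)
  have h := hA.eigenvalues_mem_spectrum_real i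
  rw [← Matrix.spectrum_toLin'] at h
  have h2 := abs_le_spectralRadius G (Module.End.hasEigenvalue_iff_mem_spectrum.2 h)
  rw [pow_mul, ← sq_abs]
  gcongr

theorem spectralRadius_pow_le_numOfSize_balancedTours (k : ℕ) :
    (spectralRadius G ^ 2) ^ k ≤ (Fintype.card V : ℝ) ^ 2 *
      ((k : ℝ) + 1) ^ (2 * Fintype.card G.Dart) * numOfSize (balancedTours G) k := by
  obtain ⟨u, hu⟩ := exists_abs_pow_le_sum_row (isGreatest_spectralRadius G).1 k
  have h : spectralRadius G ^ k ≤ Fintype.card V *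
      (((k : ℝ) + 1) ^ Fintype.card G.Dart * √(numOfSize (balancedTours G) k)) := by
    rw [abs_of_nonneg (spectralRadius_nonneg G)] at hu
    refine hu.trans ((sum_le_card_nsmul _ _ _ fun v _ => ?_).trans_eq (by
      rw [card_univ, nsmul_eq_mul]))
    rw [← card_finsetWalkLength_eq, Nat.abs_cast]
    exact card_finsetWalkLength_le k u v
  have h2 := pow_le_pow_left₀ (pow_nonneg (spectralRadius_nonneg G) k) h 2
  rw [mul_pow, mul_pow, Real.sq_sqrt (by positivity), ← pow_mul, ← pow_mul, mul_comm k,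
    pow_mul (spectralRadius G), mul_comm (Fintype.card G.Dart), ← mul_assoc] at h2
  exact h2

/-- The upper bound holds for every family and the lower bound passes to larger ones, so both
families are treated at once. -/
theorem hasGrowthRate_of_even_balancedTours_subset {F : Set (Tour G)}
    (hF : ∀ t ∈ balancedTours G, Even t.length → t ∈ F) :
    HasGrowthRate F (spectralRadius G ^ 2) := by
  have hV : (1 : ℝ) ≤ Fintype.card V := by exact_mod_cast Fintype.card_pos (α := V)
  -- The lower bound dictates `|V|^2`; the upper bound needs only `|V|`.
  refine tendsto_rpow_inv_of_le_of_le (C := (Fintype.card V : ℝ) ^ 2) (sq_nonneg _)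
    (by positivity) (2 * Fintype.card G.Dart) (fun k => Nat.cast_nonneg _) (fun k => ?_)
    fun k => ?_
  · refine (spectralRadius_pow_le_numOfSize_balancedTours G k).trans ?_
    have := numOfSize_mono hF k
    gcongr
  · refine (numOfSize_le_card_mul_spectralRadius_pow G F k).trans ?_
    gcongr
    exact le_self_pow₀ hV two_ne_zero

end Bounds

end GraphTours

theorem mainTheorem2 {V : Type*} [Fintype V] [DecidableEq V] (G : SimpleGraph V)
    [DecidableRel G.Adj] (hG : G.Connected) :
    GraphTours.HasGrowthRate (GraphTours.balancedTours G) (GraphTours.spectralRadius G ^ 2) ∧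
      GraphTours.HasGrowthRate (GraphTours.evenTours G) (GraphTours.spectralRadius G ^ 2) := by
  have := hG.nonempty
  exact ⟨GraphTours.hasGrowthRate_of_even_balancedTours_subset G fun _ ht _ => ht,
    GraphTours.hasGrowthRate_of_even_balancedTours_subset G fun _ _ ht => ht⟩
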